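/- Let $n\ge 0$ be an integer, write points of $\mathbb{R}^{n+1}$ as $(x,\rho)$ with $x\in\mathbb{R}^n$, $\rho\in\mathbb{R}$, and let $\mathbb{H}^{n+1}_-=\{(x,\rho)\in\mathbb{R}^{n+1}:\rho<0\}$. For $k\in\mathbb{R}$, let $\mathcal{S}^k(\mathbb{R}^{n+1})$ be the set of symbols of order $k$, that is, of smooth functions $a(z,\zeta)$ on $\mathbb{R}^{n+1}\times\mathbb{R}^{n+1}$ such that for every compact $K\subset\mathbb{R}^{n+1}$ and all multi-indices $\alpha,\beta$ there is a constant $C_{K,\alpha,\beta}$ with $$|\partial_z^\alpha\partial_\zeta^\beta a(z,\zeta)|\le C_{K,\alpha,\beta}(1+|\zeta|)^{k-|\beta|}\qquad(z\in K,\ \zeta\in\mathbb{R}^{n+1}).$$ Let $\Psi^k(\mathbb{R}^{n+1})$ be the set of operators $$Af(z)=\frac{1}{(2\pi)^{n+1}}\int_{\mathbb{R}^{n+1}} a(z,\zeta)\,\widehat f(\zeta)\,e^{iz\cdot\zeta}\,d\zeta,\qquad a\in\mathcal{S}^k(\mathbb{R}^{n+1}),\quad \widehat f(\zeta)=\int_{\mathbb{R}^{n+1}}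 f(z)e^{-iz\cdot\zeta}\,dz,$$ where for $f\in L^2(\mathbb{R}^{n+1})$ the Fourier transform is that of $L^2$ and $Af$ is understood as a distribution: for test functions $\psi\in C_c^\infty(\mathbb{R}^{n+1})$, $$\langle Af,\psi\rangle=\frac{1}{(2\pi)^{n+1}}\int\widehat f(\zeta)\Big(\int a(z,\zeta)e^{iz\cdot\zeta}\psi(z)\,dz\Big)d\zeta.$$ A function $f$ on $\mathbb{H}^{n+1}_-$ is extended by zero to $\mathbb{R}^{n+1}$ before $A$ is applied to it. Let $W^s(\mathbb{R}^{n+1})$ be the $L^2$-based Sobolev space of order $s$, and let $W^s(\mathbb{H}^{n+1}_-)$ be the space of restrictions of its elements to $\mathbb{H}^{n+1}_-$, with the quotient norm (the infimum of the norms of all extensions). **Theorem.** Let $k\le -1$, let $A\in\Psi^k(\mathbb{R}^{n+1})$ and let $0\le s\le|k|$. Then $Af\in W^s_{loc}(\mathbb{H}^{n+1}_-)$ for all $f\in L^2(\mathbb{H}^{n+1}_-)$, with $$\|Af\|_{W^s_{loc}(\mathbb{H}^{n+1}_-)}\lesssim\|f\|_{L^2(\mathbb{H}^{n+1}_-)};$$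 that is, for every cutoff $\varphi\in C_c^\infty(\mathbb{R}^{n+1})$ there is a constant $C$, depending only on $n,k,A,s,\varphi$, such that for all $f\in L^2(\mathbb{H}^{n+1}_-)$ the restriction of $\varphi\,Af$ to $\mathbb{H}^{n+1}_-$ belongs to $W^s(\mathbb{H}^{n+1}_-)$ and $$\|\varphi\,Af\|_{W^s(\mathbb{H}^{n+1}_-)}\le C\,\|f\|_{L^2(\mathbb{H}^{n+1}_-)}.$$ -/

import Mathlib

open MeasureTheory TopologicalSpace
open scoped ENNReal NNReal ContDiff FourierTransform Distributions SchwartzMap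

noncomputable section

namespace HalfSpace

/-- `ℝⁿ⁺¹` with its Euclidean norm. A point is `(x, ρ)`, where `ρ` is the last coordinate. -/
abbrev Space (n : ℕ) : Type := EuclideanSpace ℝ (Fin (n + 1))

/-- The open lower half-space `{(x, ρ) : ρ < 0}`. -/
def lower (n : ℕ) : Set (Space n) := {z | z (Fin.last n) < 0}

lemma measurableSet_lower (n : ℕ) : MeasurableSet (lower n) := by
  have h : Continuous fun z : Space n => z (Fin.last n) := by fun_prop
  exact (isOpen_lt h continuous_const).measurableSet

/-- Test functions on `ℝⁿ⁺¹`: complex valued, smooth and compactly supported. -/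
abbrev Test (n : ℕ) : Type := 𝓓((⊤ : Opens (Space n)), ℂ)

/-- The pointwise product of two test functions. -/
def Test.mul {n : ℕ} (φ ψ : Test n) : Test n where
  toFun z := φ z * ψ z
  contDiff' := φ.contDiff.mul ψ.contDiff
  hasCompactSupport' := φ.hasCompactSupport.mul_right
  tsupport_subset' := by simp

/-- A test function, regarded as a Schwartz function. -/
def Test.toSchwartz {n : ℕ} (ψ : Test n) : 𝓢(Space n, ℂ) :=
  ψ.hasCompactSupport.toSchwartzMap ψ.contDiff

/-- Complex functionals on test functions; `u ψ` is the bilinear pairing `⟨u, ψ⟩`, so that a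
locally integrable function `u` gives `ψ ↦ ∫ u ψ`. -/
abbrev Functional (n : ℕ) : Type := Test n → ℂ

/-- The product `φ u` of a functional with a test function: `⟨φ u, ψ⟩ = ⟨u, φ ψ⟩`. -/
def Functional.cutoff {n : ℕ} (φ : Test n) (u : Functional n) : Functional n :=
  fun ψ => u (φ.mul ψ)

/-- Symbols `a(z, ζ)` of order `k` on `ℝⁿ⁺¹` (type `(1,0)`): smooth functions such that every
derivative of order `i` in `z` and `j` in `ζ` is `O((1 + |ζ|) ^ (k - j))`, uniformly for `z` in
compact sets. -/
structure IsSymbol (n : ℕ) (k : ℝ) (a : Space n → Space n → ℂ) : Prop where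
  smooth : ContDiff ℝ ∞ fun p : Space n × Space n => a p.1 p.2
  bound : ∀ K : Set (Space n), IsCompact K → ∀ i j : ℕ, ∃ C : ℝ, ∀ z ∈ K, ∀ ζ : Space n,
    ‖iteratedFDeriv ℝ i (fun y => iteratedFDeriv ℝ j (a y) ζ) z‖ ≤ C * (1 + ‖ζ‖) ^ (k - j)

/-- The operator `Op(a)` on `L²(ℝⁿ⁺¹)`, with values in distributions:
`Op(a) f (z) = (2π)⁻⁽ⁿ⁺¹⁾ ∫ a(z, ζ) f̂(ζ) e^{i z·ζ} dζ` where `f̂(ζ) = ∫ f(z) e^{-i z·ζ} dz`,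
paired with the test function `ψ`. Here `ζ` is replaced by `2π ζ`, as Mathlib's Fourier transform
is `𝓕 f (ζ) = f̂(2π ζ)`; it is the one of `L²`. For a symbol `a`, of any order, the inner integral
is a rapidly decreasing function of `ζ`, so both integrals converge absolutely. -/
def op {n : ℕ} (a : Space n → Space n → ℂ) (f : Lp ℂ 2 (volume : Measure (Space n))) :
    Functional n :=
  fun ψ => ∫ ζ, (𝓕 f : Lp ℂ 2 (volume : Measure (Space n))) ζ *
    ∫ z, a z ((2 * Real.pi) • ζ) * Complex.exp (2 * Real.pi * Complex.I * (inner ℝ z ζ : ℝ)) * ψ z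

/-- `Ψᵏ(ℝⁿ⁺¹)`: the pseudodifferential operators of order `k` (acting on `L²(ℝⁿ⁺¹)`). -/
def Psi (n : ℕ) (k : ℝ) : Set (Lp ℂ 2 (volume : Measure (Space n)) → Functional n) :=
  {A | ∃ a, IsSymbol n k a ∧ A = op a}

/-- The space `L²` of the lower half-space. -/
abbrev L2Lower (n : ℕ) : Type := Lp ℂ 2 (volume.restrict (lower n))

/-- Extension by zero from the lower half-space to `ℝⁿ⁺¹`. -/
def extendByZero {n : ℕ} (f : L2Lower n) : Lp ℂ 2 (volume : Measure (Space n)) :=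
  MemLp.toLp ((lower n).indicator f)
    ((memLp_indicator_iff_restrict (measurableSet_lower n)).2 (Lp.memLp f))

/-- The norm of `Wˢ(ℝⁿ⁺¹)`: the `L²` norm of the Bessel potential of order `s` of `U`, and `∞` if
that is not in `L²`, that is, if `U` is not in `Wˢ(ℝⁿ⁺¹)`. -/
def sobolevNorm {n : ℕ} (s : ℝ) (U : 𝓢'(Space n, ℂ)) : ℝ≥0∞ :=
  ⨅ (g : Lp ℂ 2 (volume : Measure (Space n)))
    (_ : TemperedDistribution.besselPotential (Space n) ℂ s U = (g : 𝓢'(Space n, ℂ))), ‖g‖ₑ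

/-- The norm of `Wˢ` of the lower half-space: the infimum of the `Wˢ(ℝⁿ⁺¹)` norms of the
distributions that agree with `u` on the lower half-space, and `∞` if there is none in
`Wˢ(ℝⁿ⁺¹)`. -/
def lowerSobolevNorm {n : ℕ} (s : ℝ) (u : Functional n) : ℝ≥0∞ :=
  ⨅ (U : 𝓢'(Space n, ℂ))
    (_ : ∀ ψ : Test n, tsupport ψ ⊆ lower n → U ψ.toSchwartz = u ψ), sobolevNorm s U

/-- The seminorms of `Wˢ_loc` of the lower half-space: the `Wˢ` norm there of `φ u`. As the
cutoff `φ` is any test function on `ℝⁿ⁺¹`, they control `u` up to the boundary, not only on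
compact subsets of the open half-space. -/
def lowerSobolevLocSeminorm {n : ℕ} (s : ℝ) (φ : Test n) (u : Functional n) : ℝ≥0∞ :=
  lowerSobolevNorm s (u.cutoff φ)

end HalfSpace

end

/-! The half-space plays no role beyond restriction: `φ Op(a) f` already lies in `Wˢ` of the whole
space, so it is its own extension. On the Fourier side, `φ Op(a)` is the integral operator `𝓕f ↦ ∫
𝓕(a(·, 2πζ) φ)(η - ζ) 𝓕f(ζ) dζ`. Integration by parts in `z` bounds its kernel by `C_N (1 + |η -
ζ|)⁻ᴺ (1 + |ζ|)ᵏ` for every `N` (`IsSymbol.exists_norm_fourier_localized_le`).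

The Sobolev weight at `η` costs at most `(1 + |η - ζ|)ˢ (1 + |ζ|)ˢ`; since `s + k ≤ 0`, the powers
of `|ζ|` cancel and a convolution bound remains (`IsSymbol.exists_schur_sobolevKernel`). The Schur
test gives boundedness on `L²`, and Plancherel carries it back. As `Op(a) f` is defined by duality,
Fubini (`integral_mul_integral_swap_of_schur`) and the exchange formula for the Fourier transform
(`IsSymbol.integral_fourier_localized_mul`) identify the function so obtained with `φ Op(a) f`. -/

/-! ### The Schur test and Fubini for Schur-bounded kernels -/

section SchurTest

theorem MeasureTheory.MemLp.lintegral_enorm_sq_lt_top {γ E : Type*} [MeasurableSpace γ]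
    [NormedAddCommGroup E] {ρ : Measure γ} {w : γ → E} (hw : MemLp w 2 ρ) :
    ∫⁻ x, ‖w x‖ₑ ^ (2 : ℝ) ∂ρ < ⊤ := by
  simpa using lintegral_rpow_enorm_lt_top_of_eLpNorm_lt_top (by norm_num) (by norm_num) hw.2

variable {α β : Type*} [MeasurableSpace α] [MeasurableSpace β] {μ : Measure α} {ν : Measure β}
  [SFinite μ] [SFinite ν]

/-- The Schur test for nonnegative kernels. -/
theorem lintegral_sq_lintegral_mul_le {κ : α → β → ℝ≥0∞} (hκ : Measurable (Function.uncurry κ))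
    {u : β → ℝ≥0∞} (hu : AEMeasurable u ν) {M N : ℝ≥0∞}
    (hM : ∀ x, ∫⁻ y, κ x y ∂ν ≤ M) (hN : ∀ y, ∫⁻ x, κ x y ∂μ ≤ N) :
    ∫⁻ x, (∫⁻ y, κ x y * u y ∂ν) ^ (2 : ℝ) ∂μ ≤ M * N * ∫⁻ y, u y ^ (2 : ℝ) ∂ν := by
  have hκx (x : α) : Measurable (κ x) := hκ.comp measurable_prodMk_left
  have hκy (y : β) : Measurable fun x => κ x y := hκ.comp measurable_prodMk_right
  -- Cauchy–Schwarz for the splitting `κ u = κ^(1/2) (κ u²)^(1/2)`.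
  have hpt (x : α) : (∫⁻ y, κ x y * u y ∂ν) ^ (2 : ℝ) ≤ M * ∫⁻ y, κ x y * u y ^ (2 : ℝ) ∂ν := by
    have key := ENNReal.lintegral_mul_norm_pow_le (μ := ν) (f := κ x)
      (g := fun y => κ x y * u y ^ (2 : ℝ)) (hκx x).aemeasurable
      ((hκx x).aemeasurable.mul (hu.pow_const _)) (p := 1 / 2) (q := 1 / 2)
      (by norm_num) (by norm_num) (by norm_num)
    have hsimp (y : β) :
        κ x y ^ (1 / 2 : ℝ) * (κ x y * u y ^ (2 : ℝ)) ^ (1 / 2 : ℝ) = κ x y * u y := by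
      rw [ENNReal.mul_rpow_of_nonneg _ _ (by norm_num), ← mul_assoc,
        ← ENNReal.rpow_add_of_nonneg _ _ (by norm_num) (by norm_num), ← ENNReal.rpow_mul]
      norm_num
    simp only [hsimp] at key
    calc
      _ ≤ ((∫⁻ y, κ x y ∂ν) ^ (1 / 2 : ℝ) *
            (∫⁻ y, κ x y * u y ^ (2 : ℝ) ∂ν) ^ (1 / 2 : ℝ)) ^ (2 : ℝ) := by gcongr
      _ = (∫⁻ y, κ x y ∂ν) * ∫⁻ y, κ x y * u y ^ (2 : ℝ) ∂ν := by
        rw [ENNReal.mul_rpow_of_nonneg _ _ (by norm_num), ← ENNReal.rpow_mul, ← ENNReal.rpow_mul]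
        norm_num
      _ ≤ _ := by gcongr; exact hM x
  have hmeas : AEMeasurable (Function.uncurry fun x y => κ x y * u y ^ (2 : ℝ)) (μ.prod ν) :=
    hκ.aemeasurable.mul (hu.pow_const (2 : ℝ)).comp_snd
  calc
    _ ≤ ∫⁻ x, M * ∫⁻ y, κ x y * u y ^ (2 : ℝ) ∂ν ∂μ := lintegral_mono hpt
    _ = M * ∫⁻ x, ∫⁻ y, κ x y * u y ^ (2 : ℝ) ∂ν ∂μ :=
      lintegral_const_mul'' _ hmeas.lintegral_prod_right'
    _ = M * ∫⁻ y, ∫⁻ x, κ x y * u y ^ (2 : ℝ) ∂μ ∂ν := by rw [lintegral_lintegral_swap hmeas]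
    _ = M * ∫⁻ y, (∫⁻ x, κ x y ∂μ) * u y ^ (2 : ℝ) ∂ν := by
      congr 1
      exact lintegral_congr fun y => lintegral_mul_const _ (hκy y)
    _ ≤ M * ∫⁻ y, N * u y ^ (2 : ℝ) ∂ν := by
      gcongr with y
      exact hN y
    _ = _ := by rw [lintegral_const_mul'' _ (hu.pow_const _), mul_assoc]

variable {K : α → β → ℂ} {M : ℝ≥0∞} {F : β → ℂ}

/-- The Schur test: an integral operator with Schur-bounded kernel is bounded on `L²`. -/
theorem eLpNorm_integral_mul_le (hK : StronglyMeasurable (Function.uncurry K))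
    (hF : AEStronglyMeasurable F ν)
    (hM : ∀ x, ∫⁻ y, ‖K x y‖ₑ ∂ν ≤ M) (hN : ∀ y, ∫⁻ x, ‖K x y‖ₑ ∂μ ≤ M) :
    eLpNorm (fun x => ∫ y, K x y * F y ∂ν) 2 μ ≤ M * eLpNorm F 2 ν := by
  have key := lintegral_sq_lintegral_mul_le (κ := fun x y => ‖K x y‖ₑ) (μ := μ) hK.enorm
    hF.enorm hM hN
  rw [eLpNorm_eq_lintegral_rpow_enorm_toReal (by norm_num) (by norm_num),
    eLpNorm_eq_lintegral_rpow_enorm_toReal (by norm_num) (by norm_num)]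
  simp only [ENNReal.toReal_ofNat]
  calc
    _ ≤ (∫⁻ x, (∫⁻ y, ‖K x y‖ₑ * ‖F y‖ₑ ∂ν) ^ (2 : ℝ) ∂μ) ^ (1 / 2 : ℝ) := by
      gcongr with x
      refine (enorm_integral_le_lintegral_enorm _).trans (le_of_eq ?_)
      simp only [enorm_mul]
    _ ≤ (M * M * ∫⁻ y, ‖F y‖ₑ ^ (2 : ℝ) ∂ν) ^ (1 / 2 : ℝ) := by gcongr
    _ = _ := by
      rw [ENNReal.mul_rpow_of_nonneg _ _ (by norm_num), ENNReal.mul_rpow_of_nonneg _ _ (by norm_num),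
        ← ENNReal.rpow_add_of_nonneg _ _ (by norm_num) (by norm_num)]
      norm_num

theorem MeasureTheory.MemLp.integral_mul_of_schur (hK : StronglyMeasurable (Function.uncurry K))
    (hF : MemLp F 2 ν) (hM_top : M ≠ ⊤)
    (hM : ∀ x, ∫⁻ y, ‖K x y‖ₑ ∂ν ≤ M) (hN : ∀ y, ∫⁻ x, ‖K x y‖ₑ ∂μ ≤ M) :
    MemLp (fun x => ∫ y, K x y * F y ∂ν) 2 μ := by
  refine ⟨?_, (eLpNorm_integral_mul_le hK hF.1 hM hN).trans_lt
    (ENNReal.mul_lt_top hM_top.lt_top hF.2)⟩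
  exact (hK.aestronglyMeasurable.mul hF.1.comp_snd).integral_prod_right'

/-- Fubini applies: by the Schur test `∫ |K| |F|` is in `L²`, and Cauchy–Schwarz pairs it with
`|v|`. -/
theorem integral_mul_integral_swap_of_schur (hK : StronglyMeasurable (Function.uncurry K))
    (hF : MemLp F 2 ν) (hM_top : M ≠ ⊤)
    (hM : ∀ x, ∫⁻ y, ‖K x y‖ₑ ∂ν ≤ M) (hN : ∀ y, ∫⁻ x, ‖K x y‖ₑ ∂μ ≤ M)
    {v : α → ℂ} (hv : MemLp v 2 μ) :
    ∫ x, v x * ∫ y, K x y * F y ∂ν ∂μ = ∫ y, F y * ∫ x, K x y * v x ∂μ ∂ν := by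
  have hmeas : AEStronglyMeasurable (Function.uncurry fun x y => v x * (K x y * F y))
      (μ.prod ν) :=
    hv.1.comp_fst.mul (hK.aestronglyMeasurable.mul hF.1.comp_snd)
  have hT : AEMeasurable (fun x => ∫⁻ y, ‖K x y‖ₑ * ‖F y‖ₑ ∂ν) μ :=
    (hK.enorm.aemeasurable.mul hF.1.enorm.comp_snd).lintegral_prod_right'
  have hint : Integrable (Function.uncurry fun x y => v x * (K x y * F y)) (μ.prod ν) := by
    refine ⟨hmeas, ?_⟩
    rw [HasFiniteIntegral, lintegral_prod _ hmeas.enorm]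
    have hinner (x : α) : ∫⁻ y, ‖v x * (K x y * F y)‖ₑ ∂ν =
        ‖v x‖ₑ * ∫⁻ y, ‖K x y‖ₑ * ‖F y‖ₑ ∂ν := by
      simp only [enorm_mul]
      exact lintegral_const_mul' _ _ enorm_ne_top
    simp only [Function.uncurry_apply_pair, hinner]
    refine (ENNReal.lintegral_mul_le_Lp_mul_Lq μ Real.HolderConjugate.two_two hv.1.enorm
      hT).trans_lt (ENNReal.mul_lt_top ?_ ?_)
    · exact ENNReal.rpow_lt_top_of_nonneg (by norm_num) hv.lintegral_enorm_sq_lt_top.ne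
    · refine ENNReal.rpow_lt_top_of_nonneg (by norm_num) (ne_of_lt ?_)
      refine (lintegral_sq_lintegral_mul_le (κ := fun x y => ‖K x y‖ₑ) (μ := μ) hK.enorm
        hF.1.enorm hM hN).trans_lt ?_
      exact ENNReal.mul_lt_top (ENNReal.mul_lt_top hM_top.lt_top hM_top.lt_top)
        hF.lintegral_enorm_sq_lt_top
  calc
    _ = ∫ x, ∫ y, v x * (K x y * F y) ∂ν ∂μ := by simp only [integral_const_mul]
    _ = ∫ y, ∫ x, v x * (K x y * F y) ∂μ ∂ν := integral_integral_swap hint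
    _ = _ := by
      congr 1 with y
      rw [← integral_const_mul]
      congr 1 with x
      ring

end SchurTest

/-! ### Localized symbols and decay of their Fourier transforms -/

noncomputable section

namespace HalfSpace

variable {n : ℕ} {k : ℝ} {a : Space n → Space n → ℂ}

/-- The symbol with the frequency rescaled and the cutoff included, as a function of the point. -/
def localized (a : Space n → Space n → ℂ) (φ : Test n) (ζ : Space n) : Space n → ℂ :=
  fun z => a z ((2 * Real.pi) • ζ) * φ z

lemma IsSymbol.contDiff_left (ha : IsSymbol n k a) (ζ : Space n) :
    ContDiff ℝ ∞ fun z => a z ζ :=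
  ha.smooth.comp (contDiff_id.prodMk contDiff_const)

lemma IsSymbol.continuous_uncurry (ha : IsSymbol n k a) :
    Continuous fun p : Space n × Space n => a p.1 p.2 :=
  ha.smooth.continuous

lemma IsSymbol.contDiff_localized (ha : IsSymbol n k a) (φ : Test n) (ζ : Space n) :
    ContDiff ℝ ∞ (localized a φ ζ) :=
  (ha.contDiff_left _).mul φ.contDiff

lemma hasCompactSupport_localized (a : Space n → Space n → ℂ) (φ : Test n) (ζ : Space n) :
    HasCompactSupport (localized a φ ζ) :=
  φ.hasCompactSupport.mul_left

/-- The case `j = 0` of the symbol estimates, the only one the proof needs: no decay of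
`ζ`-derivatives enters. -/
lemma IsSymbol.exists_norm_iteratedFDeriv_le (ha : IsSymbol n k a) {K : Set (Space n)}
    (hK : IsCompact K) (i : ℕ) : ∃ C : ℝ, 0 ≤ C ∧ ∀ z ∈ K, ∀ ζ : Space n,
      ‖iteratedFDeriv ℝ i (fun y => a y ζ) z‖ ≤ C * (1 + ‖ζ‖) ^ k := by
  obtain ⟨C, hC⟩ := ha.bound K hK i 0
  refine ⟨|C|, abs_nonneg C, fun z hz ζ => ?_⟩
  have h := hC z hz ζ
  have hcomp : (fun y => iteratedFDeriv ℝ 0 (a y) ζ) =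
      (continuousMultilinearCurryFin0 ℝ (Space n) ℂ).symm ∘ fun y => a y ζ := by
    ext y
    simp
  rw [hcomp, LinearIsometryEquiv.norm_iteratedFDeriv_comp_left] at h
  refine h.trans ?_
  simp only [Nat.cast_zero, sub_zero]
  gcongr
  exact le_abs_self C

lemma IsSymbol.exists_norm_iteratedFDeriv_localized_le (ha : IsSymbol n k a) (hk : k ≤ 0)
    (φ : Test n) (i : ℕ) : ∃ C : ℝ, 0 ≤ C ∧ ∀ z ζ : Space n,
      ‖iteratedFDeriv ℝ i (localized a φ ζ) z‖ ≤ C * (1 + ‖ζ‖) ^ k := by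
  choose C hC₀ hC using
    fun j => ha.exists_norm_iteratedFDeriv_le (K := tsupport φ) φ.hasCompactSupport j
  have hφ (j : ℕ) : ∃ D, ∀ z, ‖iteratedFDeriv ℝ j φ z‖ ≤ D :=
    (φ.contDiff.continuous_iteratedFDeriv (m := j)
      (by exact_mod_cast le_top)).bounded_above_of_compact_support
      (φ.hasCompactSupport.iteratedFDeriv j)
  choose D hD using hφ
  have hD₀ (j : ℕ) : 0 ≤ D j := (norm_nonneg _).trans (hD j 0)
  refine ⟨∑ j ∈ Finset.range (i + 1), i.choose j * C j * D (i - j),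
    Finset.sum_nonneg fun j _ => mul_nonneg (mul_nonneg (by positivity) (hC₀ j)) (hD₀ _),
    fun z ζ => ?_⟩
  by_cases hz : z ∈ tsupport φ
  -- Rescaling the frequency is harmless because `2π ≥ 1` and `k ≤ 0`.
  · have hscale : (1 + ‖(2 * Real.pi) • ζ‖) ^ k ≤ (1 + ‖ζ‖) ^ k := by
      refine Real.rpow_le_rpow_of_nonpos (by positivity) ?_ hk
      rw [norm_smul, Real.norm_of_nonneg (by positivity)]
      nlinarith [norm_nonneg ζ, Real.pi_gt_three]
    refine (norm_iteratedFDeriv_mul_le (ha.contDiff_left ((2 * Real.pi) • ζ)) φ.contDiff z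
      (n := i) (by exact_mod_cast le_top)).trans ?_
    rw [Finset.sum_mul]
    refine Finset.sum_le_sum fun j _ => ?_
    calc
      _ ≤ (i.choose j : ℝ) * (C j * (1 + ‖ζ‖) ^ k) * D (i - j) := by
        have hCj := (hC j z hz ((2 * Real.pi) • ζ)).trans
          (mul_le_mul_of_nonneg_left hscale (hC₀ j))
        exact mul_le_mul (mul_le_mul_of_nonneg_left hCj (Nat.cast_nonneg _)) (hD (i - j) z)
          (norm_nonneg _) (mul_nonneg (Nat.cast_nonneg _) ((norm_nonneg _).trans hCj))
      _ = _ := by ring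
  · have hz' : z ∉ tsupport (localized a φ ζ) := fun h => hz (tsupport_mul_subset_right h)
    rw [Function.notMem_support.1 fun h => hz' (support_iteratedFDeriv_subset i h), norm_zero]
    exact mul_nonneg (Finset.sum_nonneg fun j _ =>
      mul_nonneg (mul_nonneg (by positivity) (hC₀ j)) (hD₀ _)) (by positivity)

lemma IsSymbol.exists_integral_norm_iteratedFDeriv_localized_le (ha : IsSymbol n k a)
    (hk : k ≤ 0) (φ : Test n) (i : ℕ) : ∃ C : ℝ, 0 ≤ C ∧ ∀ ζ : Space n,
      ∫ z, ‖iteratedFDeriv ℝ i (localized a φ ζ) z‖ ≤ C * (1 + ‖ζ‖) ^ k := by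
  obtain ⟨C, hC₀, hC⟩ := ha.exists_norm_iteratedFDeriv_localized_le hk φ i
  refine ⟨C * volume.real (tsupport φ), by positivity, fun ζ => ?_⟩
  have hsub : ∀ z ∉ tsupport φ, ‖iteratedFDeriv ℝ i (localized a φ ζ) z‖ = 0 := fun z hz => by
    have hz' : z ∉ tsupport (localized a φ ζ) := fun h => hz (tsupport_mul_subset_right h)
    rw [Function.notMem_support.1 fun h => hz' (support_iteratedFDeriv_subset i h), norm_zero]
  rw [← setIntegral_eq_integral_of_forall_compl_eq_zero hsub]
  refine (Real.le_norm_self _).trans ((norm_setIntegral_le_of_norm_le_const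
    (C := C * (1 + ‖ζ‖) ^ k) φ.hasCompactSupport.isCompact.measure_lt_top
    fun z _ => ?_).trans_eq (by ring))
  rw [norm_norm]
  exact hC z ζ

/-- Integration by parts in `z`; compact support makes every derivative integrable. -/
lemma IsSymbol.pow_mul_norm_fourier_localized_le (ha : IsSymbol n k a) (φ : Test n) (N : ℕ)
    (ζ ξ : Space n) : ‖ξ‖ ^ N * ‖𝓕 (localized a φ ζ) ξ‖ ≤
      2 ^ N * ∑ i ∈ Finset.range (N + 1), ∫ z, ‖iteratedFDeriv ℝ i (localized a φ ζ) z‖ := by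
  have hint (j i : ℕ) : Integrable fun z => ‖z‖ ^ j * ‖iteratedFDeriv ℝ i (localized a φ ζ) z‖ := by
    have hc := (ha.contDiff_localized φ ζ).continuous_iteratedFDeriv (m := i)
      (by exact_mod_cast le_top)
    exact ((continuous_norm.pow j).mul hc.norm).integrable_of_hasCompactSupport
      (((hasCompactSupport_localized a φ ζ).iteratedFDeriv i).norm.mul_left)
  have h := Real.pow_mul_norm_iteratedFDeriv_fourier_le (K := ⊤) (N := ⊤) (k := 0) (n := N)
    (ha.contDiff_localized φ ζ) (fun j i _ _ => hint j i) (by simp) (by simp) ξ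
  simpa [Finset.range_one, Finset.singleton_product] using h

/-- Rapid decay of the Fourier transform in the point of a localized symbol. -/
lemma IsSymbol.exists_norm_fourier_localized_le (ha : IsSymbol n k a) (hk : k ≤ 0)
    (φ : Test n) (N : ℕ) : ∃ C : ℝ, 0 ≤ C ∧ ∀ ζ ξ : Space n,
      (1 + ‖ξ‖) ^ N * ‖𝓕 (localized a φ ζ) ξ‖ ≤ C * (1 + ‖ζ‖) ^ k := by
  choose C hC₀ hC using ha.exists_integral_norm_iteratedFDeriv_localized_le hk φ
  have hb (m : ℕ) (ζ ξ : Space n) : ‖ξ‖ ^ m * ‖𝓕 (localized a φ ζ) ξ‖ ≤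
      (2 ^ m * ∑ i ∈ Finset.range (m + 1), C i) * (1 + ‖ζ‖) ^ k := by
    refine (ha.pow_mul_norm_fourier_localized_le φ m ζ ξ).trans ?_
    rw [mul_assoc, Finset.sum_mul]
    gcongr with i
    exact hC i ζ
  -- From `(1 + t)ᴺ ≤ 2ᴺ⁻¹ (1 + tᴺ)`, with the bound `hb` used for the exponents `0` and `N`.
  refine ⟨2 ^ (N - 1) * ((2 ^ 0 * ∑ i ∈ Finset.range (0 + 1), C i) +
    2 ^ N * ∑ i ∈ Finset.range (N + 1), C i), ?_, fun ζ ξ => ?_⟩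
  · have := fun m => Finset.sum_nonneg (s := Finset.range m) fun i _ => hC₀ i
    have h1 := this (0 + 1)
    have h2 := this (N + 1)
    positivity
  · calc
      _ ≤ 2 ^ (N - 1) * (1 ^ N + ‖ξ‖ ^ N) * ‖𝓕 (localized a φ ζ) ξ‖ := by
        gcongr
        exact add_pow_le zero_le_one (norm_nonneg ξ) N
      _ = 2 ^ (N - 1) * (‖ξ‖ ^ 0 * ‖𝓕 (localized a φ ζ) ξ‖ +
          ‖ξ‖ ^ N * ‖𝓕 (localized a φ ζ) ξ‖) := by ring
      _ ≤ 2 ^ (N - 1) * ((2 ^ 0 * ∑ i ∈ Finset.range (0 + 1), C i) * (1 + ‖ζ‖) ^ k +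
          (2 ^ N * ∑ i ∈ Finset.range (N + 1), C i) * (1 + ‖ζ‖) ^ k) := by
        exact mul_le_mul_of_nonneg_left (add_le_add (hb 0 ζ ξ) (hb N ζ ξ)) (by positivity)
      _ = _ := by ring

/-! ### Schur bounds for the weighted kernel -/

/-- The kernel on the Fourier side of `f ↦ φ Op(a) f`, weighted for the Sobolev order `s`. -/
def sobolevKernel (s : ℝ) (a : Space n → Space n → ℂ) (φ : Test n) (η ζ : Space n) : ℂ :=
  ((1 + ‖η‖ ^ 2) ^ (s / 2) : ℝ) * 𝓕 (localized a φ ζ) (η - ζ)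

/-- A form of Peetre's inequality, from `1 + |η| ≤ (1 + |η - ζ|)(1 + |ζ|)`. -/
lemma one_add_norm_sq_rpow_le {E : Type*} [SeminormedAddCommGroup E] {s : ℝ} (hs : 0 ≤ s)
    (η ζ : E) : (1 + ‖η‖ ^ 2) ^ (s / 2) ≤ (1 + ‖η - ζ‖) ^ s * (1 + ‖ζ‖) ^ s := by
  calc
    (1 + ‖η‖ ^ 2) ^ (s / 2) ≤ ((1 + ‖η‖) ^ (2 : ℝ)) ^ (s / 2) := by
      gcongr
      rw [Real.rpow_two]
      nlinarith [norm_nonneg η]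
    _ = (1 + ‖η‖) ^ s := by
      rw [← Real.rpow_mul (by positivity)]
      congr 1
      ring
    _ ≤ ((1 + ‖η - ζ‖) * (1 + ‖ζ‖)) ^ s := by
      gcongr
      have := norm_add_le (η - ζ) ζ
      rw [sub_add_cancel] at this
      nlinarith [norm_nonneg ζ, norm_nonneg (η - ζ)]
    _ = _ := Real.mul_rpow (by positivity) (by positivity)

/-- The order condition acts here, through `(1 + |ζ|)^(s + k) ≤ 1`; the other factor `(1 + |η -
ζ|)ˢ` is absorbed by taking `⌈s + r⌉₊` powers of decay. -/
lemma IsSymbol.exists_norm_sobolevKernel_le (ha : IsSymbol n k a) {s : ℝ} (hs : 0 ≤ s)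
    (hsk : s + k ≤ 0) (φ : Test n) (r : ℝ) : ∃ C : ℝ, 0 ≤ C ∧ ∀ η ζ : Space n,
      ‖sobolevKernel s a φ η ζ‖ ≤ C * (1 + ‖η - ζ‖) ^ (-r) := by
  obtain ⟨C, hC₀, hC⟩ := ha.exists_norm_fourier_localized_le (by linarith) φ ⌈s + r⌉₊
  refine ⟨C, hC₀, fun η ζ => ?_⟩
  have hpos : (0 : ℝ) < 1 + ‖η - ζ‖ := by positivity
  have hone : 1 ≤ 1 + ‖η - ζ‖ := by linarith [norm_nonneg (η - ζ)]
  have hpow : (1 + ‖η - ζ‖) ^ (s + r) ≤ (1 + ‖η - ζ‖) ^ ⌈s + r⌉₊ := by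
    rw [← Real.rpow_natCast]
    exact Real.rpow_le_rpow_of_exponent_le hone (Nat.le_ceil _)
  have hζ : (1 + ‖ζ‖) ^ s * (1 + ‖ζ‖) ^ k ≤ 1 := by
    rw [← Real.rpow_add (by positivity)]
    exact Real.rpow_le_one_of_one_le_of_nonpos (by linarith [norm_nonneg ζ]) hsk
  rw [sobolevKernel, norm_mul, Complex.norm_real, Real.norm_of_nonneg (by positivity)]
  calc
    _ ≤ ((1 + ‖η - ζ‖) ^ s * (1 + ‖ζ‖) ^ s) * ‖𝓕 (localized a φ ζ) (η - ζ)‖ := by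
      gcongr
      exact one_add_norm_sq_rpow_le hs η ζ
    _ = (1 + ‖η - ζ‖) ^ (-r) * (1 + ‖ζ‖) ^ s *
        ((1 + ‖η - ζ‖) ^ (s + r) * ‖𝓕 (localized a φ ζ) (η - ζ)‖) := by
      rw [Real.rpow_add hpos, Real.rpow_neg hpos.le]
      have := (Real.rpow_pos_of_pos hpos r).ne'
      field_simp
    _ ≤ (1 + ‖η - ζ‖) ^ (-r) * (1 + ‖ζ‖) ^ s * (C * (1 + ‖ζ‖) ^ k) := by
      exact mul_le_mul_of_nonneg_left
        ((mul_le_mul_of_nonneg_right hpow (norm_nonneg _)).trans (hC ζ (η - ζ))) (by positivity)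
    _ = C * (1 + ‖η - ζ‖) ^ (-r) * ((1 + ‖ζ‖) ^ s * (1 + ‖ζ‖) ^ k) := by ring
    _ ≤ C * (1 + ‖η - ζ‖) ^ (-r) := mul_le_of_le_one_right (by positivity) hζ

lemma IsSymbol.stronglyMeasurable_sobolevKernel (ha : IsSymbol n k a) (s : ℝ) (φ : Test n) :
    StronglyMeasurable (Function.uncurry (sobolevKernel s a φ)) := by
  have hw : Continuous fun p : Space n × Space n => (((1 + ‖p.1‖ ^ 2) ^ (s / 2) : ℝ) : ℂ) := by
    refine Complex.continuous_ofReal.comp (Continuous.rpow_const (by fun_prop) fun p => ?_)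
    exact Or.inl (by positivity)
  have hc : Continuous fun q : (Space n × Space n) × Space n =>
      Complex.exp (↑(-2 * Real.pi * inner ℝ q.2 (q.1.1 - q.1.2)) * Complex.I) •
        (a q.2 ((2 * Real.pi) • q.1.2) * φ q.2) := by
    have h1 : Continuous fun q : (Space n × Space n) × Space n =>
        a q.2 ((2 * Real.pi) • q.1.2) :=
      ha.continuous_uncurry.comp (continuous_snd.prodMk (by fun_prop))
    have h2 : Continuous fun q : (Space n × Space n) × Space n => φ q.2 :=
      φ.contDiff.continuous.comp continuous_snd
    have h3 : Continuous fun q : (Space n × Space n) × Space n =>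
        Complex.exp (↑(-2 * Real.pi * inner ℝ q.2 (q.1.1 - q.1.2)) * Complex.I) := by
      fun_prop
    exact h3.smul (h1.mul h2)
  have hF := hc.stronglyMeasurable.integral_prod_right' (ν := (volume : Measure (Space n)))
  have heq : Function.uncurry (sobolevKernel s a φ) = fun p : Space n × Space n =>
      (((1 + ‖p.1‖ ^ 2) ^ (s / 2) : ℝ) : ℂ) * ∫ z,
        Complex.exp (↑(-2 * Real.pi * inner ℝ z (p.1 - p.2)) * Complex.I) •
          (a z ((2 * Real.pi) • p.2) * φ z) := by
    ext p
    simp only [Function.uncurry, sobolevKernel, Real.fourier_eq', localized]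
  rw [heq]
  exact hw.stronglyMeasurable.mul hF

/-- The weighted kernel is integrable in either variable, uniformly in the other one. -/
lemma IsSymbol.exists_schur_sobolevKernel (ha : IsSymbol n k a) {s : ℝ} (hs : 0 ≤ s)
    (hsk : s + k ≤ 0) (φ : Test n) : ∃ M : ℝ≥0,
      (∀ η, ∫⁻ ζ, ‖sobolevKernel s a φ η ζ‖ₑ ≤ M) ∧
      ∀ ζ, ∫⁻ η, ‖sobolevKernel s a φ η ζ‖ₑ ≤ M := by
  -- The exponent `n + 2` exceeds the dimension `n + 1`, so the bound is integrable.
  obtain ⟨C, hC₀, hC⟩ := ha.exists_norm_sobolevKernel_le hs hsk φ (n + 2)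
  have hint : Integrable fun x : Space n => C * (1 + ‖x‖) ^ (-((n : ℝ) + 2)) :=
    (integrable_one_add_norm (by simp)).const_mul C
  set h : Space n → ℝ≥0∞ := fun x => ‖C * (1 + ‖x‖) ^ (-((n : ℝ) + 2))‖ₑ
  have hle (η ζ : Space n) : ‖sobolevKernel s a φ η ζ‖ₑ ≤ h (η - ζ) :=
    enorm_le_iff_norm_le.2 ((hC η ζ).trans (Real.le_norm_self _))
  have hfin : ∫⁻ x, h x ≠ ⊤ := hint.2.ne
  refine ⟨(∫⁻ x, h x).toNNReal, fun η => ?_, fun ζ => ?_⟩ <;> rw [ENNReal.coe_toNNReal hfin]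
  · exact (lintegral_mono fun ζ => hle η ζ).trans_eq (lintegral_sub_left_eq_self h η)
  · exact (lintegral_mono fun η => hle η ζ).trans_eq (lintegral_sub_right_eq_self h ζ)

/-! ### Sobolev norms and pairings on the Fourier side -/

lemma enorm_extendByZero (f : L2Lower n) : ‖extendByZero f‖ₑ = ‖f‖ₑ := by
  rw [Lp.enorm_def, Lp.enorm_def, extendByZero, eLpNorm_congr_ae (MemLp.coeFn_toLp _),
    eLpNorm_indicator_eq_eLpNorm_restrict (measurableSet_lower n)]

lemma enorm_fourier (f : Lp ℂ 2 (volume : Measure (Space n))) :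
    ‖(𝓕 f : Lp ℂ 2 (volume : Measure (Space n)))‖ₑ = ‖f‖ₑ :=
  enorm_eq_iff_norm_eq.2 (Lp.norm_fourier_eq f)

lemma sobolevNorm_besselPotential_neg_le (s : ℝ) (g : Lp ℂ 2 (volume : Measure (Space n))) :
    sobolevNorm s (TemperedDistribution.besselPotential (Space n) ℂ (-s) (g : 𝓢'(Space n, ℂ))) ≤
      ‖g‖ₑ :=
  iInf₂_le g (by simp)

lemma lowerSobolevNorm_le {s : ℝ} {u : Functional n} (U : 𝓢'(Space n, ℂ))
    (hU : ∀ ψ : Test n, U ψ.toSchwartz = u ψ) : lowerSobolevNorm s u ≤ sobolevNorm s U :=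
  iInf₂_le U fun ψ _ => hU ψ

/-- The localized symbol modulated by the character of frequency `ζ`, as a Schwartz function. -/
def IsSymbol.modulated (ha : IsSymbol n k a) (φ : Test n) (ζ : Space n) : 𝓢(Space n, ℂ) :=
  HasCompactSupport.toSchwartzMap
    (f := fun z => Complex.exp (2 * Real.pi * Complex.I * (inner ℝ z ζ : ℝ)) * localized a φ ζ z)
    (hasCompactSupport_localized a φ ζ).mul_left
    (ContDiff.mul (by
      have h : ContDiff ℝ ∞ fun z : Space n => ((inner ℝ z ζ : ℝ) : ℂ) :=
        Complex.ofRealCLM.contDiff.comp (contDiff_id.inner ℝ contDiff_const)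
      exact (contDiff_const.mul h).cexp) (ha.contDiff_localized φ ζ))

lemma IsSymbol.modulated_apply (ha : IsSymbol n k a) (φ : Test n) (ζ z : Space n) :
    ha.modulated φ ζ z =
      Complex.exp (2 * Real.pi * Complex.I * (inner ℝ z ζ : ℝ)) * localized a φ ζ z :=
  rfl

lemma IsSymbol.fourier_modulated_apply (ha : IsSymbol n k a) (φ : Test n) (ζ η : Space n) :
    𝓕 (ha.modulated φ ζ) η = 𝓕 (localized a φ ζ) (η - ζ) := by
  rw [SchwartzMap.fourier_coe, Real.fourier_eq', Real.fourier_eq']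
  congr 1 with z
  rw [ha.modulated_apply, smul_eq_mul, smul_eq_mul, ← mul_assoc, ← Complex.exp_add, inner_sub_right]
  congr 2
  push_cast
  ring

/-- Modulation by `ζ` translates the Fourier transform, so moving `𝓕` to the other factor turns the
kernel into the inner integral of `op` tested on `φ ψ`. -/
lemma IsSymbol.integral_fourier_localized_mul (ha : IsSymbol n k a) (φ ψ : Test n)
    (ζ : Space n) :
    ∫ η, 𝓕 (localized a φ ζ) (η - ζ) * 𝓕⁻ ψ.toSchwartz η =
      ∫ z, a z ((2 * Real.pi) • ζ) * Complex.exp (2 * Real.pi * Complex.I * (inner ℝ z ζ : ℝ)) *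
        φ.mul ψ z := by
  have h := SchwartzMap.integral_fourier_mul_eq (ha.modulated φ ζ) (𝓕⁻ ψ.toSchwartz)
  simp only [FourierTransform.fourier_fourierInv_eq, ha.fourier_modulated_apply,
    ha.modulated_apply] at h
  rw [h]
  congr 1 with z
  change _ * (a z _ * φ z) * ψ z = _ * _ * (φ z * ψ z)
  ring

/-- Pairing a Bessel potential of order `-s` with a test function on the Fourier side. -/
lemma besselPotential_neg_fourierInv_apply (s : ℝ) (h : Lp ℂ 2 (volume : Measure (Space n)))
    (ψ : 𝓢(Space n, ℂ)) :
    TemperedDistribution.besselPotential (Space n) ℂ (-s)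
      ((𝓕⁻ h : Lp ℂ 2 (volume : Measure (Space n))) : 𝓢'(Space n, ℂ)) ψ =
    ∫ η, SchwartzMap.smulLeftCLM ℂ (fun x : Space n => (((1 + ‖x‖ ^ 2) ^ (-s / 2) : ℝ) : ℂ))
      (𝓕⁻ ψ) η * h η := by
  rw [TemperedDistribution.besselPotential,
    TemperedDistribution.fourierMultiplierCLM_apply_apply,
    ← TemperedDistribution.fourier_apply, Lp.fourier_toTemperedDistribution_eq,
    FourierTransform.fourier_fourierInv_eq, Lp.toTemperedDistribution_apply]
  rfl

/-- A pseudodifferential operator of order `k ≤ 0`, cut off, maps `L²` to `Wˢ` for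
`0 ≤ s ≤ -k`. -/
theorem IsSymbol.exists_lowerSobolevLocSeminorm_op_le (ha : IsSymbol n k a) {s : ℝ} (hs : 0 ≤ s)
    (hsk : s + k ≤ 0) (φ : Test n) : ∃ C : ℝ≥0, ∀ f : Lp ℂ 2 (volume : Measure (Space n)),
      lowerSobolevLocSeminorm s φ (op a f) ≤ C * ‖f‖ₑ := by
  obtain ⟨M, hM, hN⟩ := ha.exists_schur_sobolevKernel hs hsk φ
  refine ⟨M, fun f => ?_⟩
  have hK := ha.stronglyMeasurable_sobolevKernel s φ
  have hF := Lp.memLp (𝓕 f : Lp ℂ 2 (volume : Measure (Space n)))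
  -- This `L²` function is the weighted Fourier transform of `φ Op(a) f`; the Bessel potential of
  -- order `-s` of its inverse transform will be the extension.
  have hH := hF.integral_mul_of_schur hK ENNReal.coe_ne_top hM hN
  have hnorm : ‖hH.toLp‖ₑ ≤ M * ‖f‖ₑ := by
    rw [← enorm_fourier f, Lp.enorm_def, Lp.enorm_def, eLpNorm_congr_ae hH.coeFn_toLp]
    exact eLpNorm_integral_mul_le hK hF.1 hM hN
  have hinv : ‖(𝓕⁻ hH.toLp : Lp ℂ 2 (volume : Measure (Space n)))‖ₑ = ‖hH.toLp‖ₑ := by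
    rw [← enorm_fourier, FourierTransform.fourier_fourierInv_eq]
  refine (lowerSobolevNorm_le (TemperedDistribution.besselPotential (Space n) ℂ (-s)
    ((𝓕⁻ hH.toLp : Lp ℂ 2 (volume : Measure (Space n))) : 𝓢'(Space n, ℂ))) fun ψ => ?_).trans
    ((sobolevNorm_besselPotential_neg_le s _).trans (hinv.trans_le hnorm))
  rw [besselPotential_neg_fourierInv_apply, Functional.cutoff, op]
  set v := SchwartzMap.smulLeftCLM ℂ
    (fun x : Space n => (((1 + ‖x‖ ^ 2) ^ (-s / 2) : ℝ) : ℂ)) (𝓕⁻ ψ.toSchwartz) with hv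
  -- The weight of order `s` in the kernel cancels the weight of order `-s` on the test function.
  have hKv (η ζ : Space n) :
      sobolevKernel s a φ η ζ * v η = 𝓕 (localized a φ ζ) (η - ζ) * 𝓕⁻ ψ.toSchwartz η := by
    have hw : ((1 + ‖η‖ ^ 2) ^ (s / 2) : ℝ) * (1 + ‖η‖ ^ 2) ^ (-s / 2) = 1 := by
      rw [← Real.rpow_add (by positivity)]
      simp [neg_div]
    rw [hv, SchwartzMap.smulLeftCLM_apply_apply (by fun_prop), sobolevKernel, smul_eq_mul]
    calc
      _ = (((1 + ‖η‖ ^ 2) ^ (s / 2) * (1 + ‖η‖ ^ 2) ^ (-s / 2) : ℝ) : ℂ) *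
          (𝓕 (localized a φ ζ) (η - ζ) * 𝓕⁻ ψ.toSchwartz η) := by
        push_cast
        ring
      _ = _ := by rw [hw, Complex.ofReal_one, one_mul]
  calc
    _ = ∫ η, v η * ∫ ζ, sobolevKernel s a φ η ζ *
        (𝓕 f : Lp ℂ 2 (volume : Measure (Space n))) ζ := by
      refine integral_congr_ae ?_
      filter_upwards [hH.coeFn_toLp] with η hη
      rw [hη]
    _ = ∫ ζ, (𝓕 f : Lp ℂ 2 (volume : Measure (Space n))) ζ *
        ∫ η, sobolevKernel s a φ η ζ * v η :=
      integral_mul_integral_swap_of_schur hK hF ENNReal.coe_ne_top hM hN (v.memLp 2)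
    _ = _ := by simp only [hKv, ha.integral_fourier_localized_mul]

end HalfSpace

end

theorem mainTheorem4 (n : ℕ) (k : ℝ) (hk : k ≤ -1)
    (A : Lp ℂ 2 (volume : Measure (HalfSpace.Space n)) → HalfSpace.Functional n)
    (hA : A ∈ HalfSpace.Psi n k) (s : ℝ) (hs₀ : 0 ≤ s) (hs : s ≤ |k|) (φ : HalfSpace.Test n) :
    ∃ C : ℝ≥0, ∀ f : HalfSpace.L2Lower n,
      HalfSpace.lowerSobolevLocSeminorm s φ (A (HalfSpace.extendByZero f)) ≤ C * ‖f‖ₑ := by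
  obtain ⟨a, ha, rfl⟩ := hA
  have hsk : s + k ≤ 0 := by
    rw [abs_of_nonpos (by linarith)] at hs
    linarith
  obtain ⟨C, hC⟩ := ha.exists_lowerSobolevLocSeminorm_op_le hs₀ hsk φ
  exact ⟨C, fun f => (hC _).trans_eq (by rw [HalfSpace.enorm_extendByZero])⟩
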